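/- Fix integers $N_t,N_r\ge 1$ and a real $\rho>0$ (the average SNR). A transmitter with $N_t$ antennas serves $K$ users with $N_r$ antennas each. The channel matrices $\mathbf H_1,\dots,\mathbf H_K\in\mathbb C^{N_r\times N_t}$ are independent, each with independent standard complex Gaussian entries (circularly symmetric, mean $0$, variance $1$). Let $\mathbf h_{i,j}$ be the $j$th column of $\mathbf H_i$, and let $\mathbf H_i^{\{k\}}$ be $\mathbf H_i$ with its $k$th column removed. The SINR of user $i$ for the stream of transmit antenna $k$ is, for the maximum ratio combining (MRC), zero forcing (ZF) and minimum mean squared error (MMSE) receiver respectively, \[ \gamma_{i,k}^{\rm MRC}=\frac{\frac{\rho}{N_t}|\mathbf h_{i,k}^\dagger\mathbf h_{i,k}|^2}{\frac{\rho}{N_t}\sum_{j\ne k}|\mathbf h_{i,k}^\dagger\mathbf h_{i,j}|^2+|\mathbf h_{i,k}^\dagger\mathbf h_{i,k}|},\qquad \gamma_{i,k}^{\rm ZF}=\frac{\rho}{N_t\,[(\mathbf H_i^\dagger\mathbf H_i)^{-1}]_{k,k}}, \] \[ \gamma_{i,k}^{\rm MMSE}=\frac{\rho}{N_t}\,\mathbf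 h_{i,k}^\dagger\Bigl(\frac{\rho}{N_t}\mathbf H_i^{\{k\}}(\mathbf H_i^{\{k\}})^\dagger+\mathbf I_{N_r}\Bigr)^{-1}\mathbf h_{i,k}, \] where for ZF it is assumed that $N_r\ge N_t$. All users employ the same receiver. Each transmit antenna sends an independent stream to the user with the largest SINR for that antenna, so that the maximum sum-rate is \[ R^{\max}_K(\rho)=\sum_{k=1}^{N_t}\mathrm E\Bigl[\log_2\bigl(1+\max_{1\le i\le K}\gamma_{i,k}\bigr)\Bigr]. \] Then, for each of the three receivers, these expectations are finite and, as $K\to\infty$ with $N_t,N_r,\rho$ fixed, \[ R^{\max}_K(\rho)=N_t\left(\log_2\ln K+\log_2\rho-\log_2 N_t\right)+\mathcal O\left(\frac{\ln\ln K}{\ln K}\right). \] -/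

import Mathlib

open Filter MeasureTheory ProbabilityTheory
open scoped Matrix Topology

noncomputable section

namespace MIMO

/-- The circularly symmetric complex Gaussian law of mean `0` and variance `1`: real and imaginary
parts are independent real Gaussians of mean `0` and variance `1/2`. -/
def stdComplexGaussian : Measure ℂ :=
  ((gaussianReal 0 (1 / 2)).prod (gaussianReal 0 (1 / 2))).map
    (fun p : ℝ × ℝ => (⟨p.1, p.2⟩ : ℂ))

instance : IsProbabilityMeasure stdComplexGaussian :=
  Measure.isProbabilityMeasure_map
    (Complex.measurableEquivRealProd.symm.measurable).aemeasurable

/-- The law of one user's Rayleigh fading channel matrix (`Nr` rows, `Nt` columns): all entries are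
independent standard complex Gaussians. -/
def channelLaw (Nr Nt : ℕ) : Measure (Fin Nr → Fin Nt → ℂ) :=
  Measure.pi fun _ => Measure.pi fun _ => stdComplexGaussian

instance (Nr Nt : ℕ) : IsProbabilityMeasure (channelLaw Nr Nt) := by
  unfold channelLaw; infer_instance

/-- The joint law of the channel matrices of `K` independent users. -/
def usersLaw (K Nr Nt : ℕ) : Measure (Fin K → Fin Nr → Fin Nt → ℂ) :=
  Measure.pi fun _ => channelLaw Nr Nt

instance (K Nr Nt : ℕ) : IsProbabilityMeasure (usersLaw K Nr Nt) := by
  unfold usersLaw; infer_instance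

/-- The three linear receivers: maximum ratio combining, zero forcing, and minimum mean squared
error. -/
inductive Receiver
  | MRC
  | ZF
  | MMSE

variable {Nr Nt : ℕ}

/-- SINR of the stream of transmit antenna `k` after MRC reception, `H.col j` being the `j`-th
column of the channel matrix. -/
def sinrMRC (ρ : ℝ) (H : Matrix (Fin Nr) (Fin Nt) ℂ) (k : Fin Nt) : ℝ :=
  (ρ / Nt * ‖star (H.col k) ⬝ᵥ H.col k‖ ^ 2) /
    (ρ / Nt * ∑ j ∈ Finset.univ.erase k, ‖star (H.col k) ⬝ᵥ H.col j‖ ^ 2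
      + ‖star (H.col k) ⬝ᵥ H.col k‖)

/-- SINR of the stream of transmit antenna `k` after zero forcing. The diagonal entry of the
Hermitian matrix `(Hᴴ * H)⁻¹` is real. -/
def sinrZF (ρ : ℝ) (H : Matrix (Fin Nr) (Fin Nt) ℂ) (k : Fin Nt) : ℝ :=
  ρ / (Nt * ((Hᴴ * H)⁻¹ k k).re)

/-- The channel matrix with its `k`-th column removed. -/
def removeCol (H : Matrix (Fin Nr) (Fin Nt) ℂ) (k : Fin Nt) :
    Matrix (Fin Nr) {j : Fin Nt // j ≠ k} ℂ :=
  H.submatrix id Subtype.val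

/-- SINR of the stream of transmit antenna `k` after MMSE reception. The quadratic form of a
Hermitian matrix is real. -/
def sinrMMSE (ρ : ℝ) (H : Matrix (Fin Nr) (Fin Nt) ℂ) (k : Fin Nt) : ℝ :=
  ρ / Nt * (star (H.col k) ⬝ᵥ
    ((((ρ / Nt : ℝ) : ℂ) • (removeCol H k * (removeCol H k)ᴴ) + 1)⁻¹ *ᵥ H.col k)).re

/-- SINR of the stream of transmit antenna `k` at a user with channel matrix `H`. -/
def sinr (r : Receiver) (ρ : ℝ) (H : Matrix (Fin Nr) (Fin Nt) ℂ) (k : Fin Nt) : ℝ :=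
  match r with
  | .MRC => sinrMRC ρ H k
  | .ZF => sinrZF ρ H k
  | .MMSE => sinrMMSE ρ H k

/-- The instantaneous rate of transmit antenna `k` under opportunistic scheduling: the antenna
serves the user whose SINR for this antenna is the largest among the `K` users. -/
def streamRate (r : Receiver) (ρ : ℝ) {K : ℕ} (k : Fin Nt)
    (H : Fin K → Fin Nr → Fin Nt → ℂ) : ℝ :=
  Real.logb 2 (1 + ⨆ i : Fin K, sinr r ρ (Matrix.of (H i)) k)

/-- The maximum sum-rate with `K` users: the sum over the transmit antennas of the expected
rate. -/
def maxSumRate (r : Receiver) (ρ : ℝ) (Nr Nt K : ℕ) : ℝ :=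
  ∑ k : Fin Nt, ∫ H, streamRate r ρ k H ∂(usersLaw K Nr Nt)

end MIMO

end

/-! Write `a = ρ / Nt`. The three receivers share one upper bound, `a` times the squared norm of
column `k` (`sinr_le`), a Gamma variable of shape `Nr` whose moment generating function is `(1 -
s)⁻ⁿ` with `n = Nr`. In the other direction, each receiver has a channel matrix of energy at most
`y² + Nt` near which its SINR is at least `a (y² - C)` (`exists_box_le_sinr`). A box of side of
order `1 / y²` around it has probability at least a negative power of `y` times `exp (-y²)`, so the
SINR has tail `exp (-t)` at level about `a t`, up to polynomial factors
(`exists_le_channelLaw_sinr`). No exact SINR distribution is needed.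

The maximum of `K` independent copies is then of size `a log K`, with corrections of order `log log
K`, hence relative error `log log K / log K`. For the mean of the logarithm, the upper bound comes
from Jensen-type tangent inequalities with exponential moments (`integral_log_one_add_iSup_le`), and
the lower bound from the probability that all users miss a threshold
(`le_integral_log_one_add_iSup`). `isBigO_integral_log_one_add_iSup` joins the two. -/

noncomputable section

namespace MIMO

/-! ### Quadratic forms of resolvents and inverse Gram matrices -/

section DotProduct

variable {m n : Type*} [Fintype m] [Fintype n]

/-- The squared Euclidean norm of a complex vector. -/
def normSq (v : m → ℂ) : ℝ := ∑ i, ‖v i‖ ^ 2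

lemma normSq_nonneg (v : m → ℂ) : 0 ≤ normSq v :=
  Finset.sum_nonneg fun _ _ => sq_nonneg _

lemma sq_norm_le_normSq (v : m → ℂ) (i : m) : ‖v i‖ ^ 2 ≤ normSq v :=
  Finset.single_le_sum (f := fun i => ‖v i‖ ^ 2) (fun _ _ => sq_nonneg _) (Finset.mem_univ i)

lemma star_dotProduct_self (v : m → ℂ) : star v ⬝ᵥ v = (normSq v : ℂ) := by
  simp only [dotProduct, normSq, Pi.star_apply, Complex.ofReal_sum]
  refine Finset.sum_congr rfl fun i _ => ?_
  rw [RCLike.star_def, mul_comm, Complex.mul_conj']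
  norm_cast

lemma norm_star_dotProduct_self (v : m → ℂ) : ‖star v ⬝ᵥ v‖ = normSq v := by
  rw [star_dotProduct_self, Complex.norm_real, Real.norm_of_nonneg (normSq_nonneg v)]

lemma normSq_star (v : m → ℂ) : normSq (star v) = normSq v := by
  simp [normSq]

lemma sq_norm_dotProduct_le (v w : m → ℂ) : ‖v ⬝ᵥ w‖ ^ 2 ≤ normSq v * normSq w := by
  have h1 : ‖v ⬝ᵥ w‖ ≤ ∑ i, ‖v i‖ * ‖w i‖ :=
    (norm_sum_le _ _).trans_eq (by simp)
  calc ‖v ⬝ᵥ w‖ ^ 2 ≤ (∑ i, ‖v i‖ * ‖w i‖) ^ 2 := by gcongr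
    _ ≤ _ := Finset.sum_mul_sq_le_sq_mul_sq _ _ _

lemma sq_norm_star_dotProduct_le (v w : m → ℂ) :
    ‖star v ⬝ᵥ w‖ ^ 2 ≤ normSq v * normSq w := by
  simpa only [normSq_star] using sq_norm_dotProduct_le (star v) w

lemma normSq_mulVec_le (B : Matrix m n ℂ) (v : n → ℂ) :
    normSq (B *ᵥ v) ≤ (∑ i, normSq (B i)) * normSq v := by
  rw [Finset.sum_mul]
  exact Finset.sum_le_sum fun i _ => sq_norm_dotProduct_le (B i) v

lemma normSq_eq_zero {v : m → ℂ} (h : normSq v = 0) : v = 0 := by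
  ext i
  have := (sq_norm_le_normSq v i).trans_eq h
  have : ‖v i‖ = 0 := by nlinarith [norm_nonneg (v i)]
  simpa using this

/-- `⟨u, B Bᴴ u⟩ = ‖Bᴴ u‖²`. -/
lemma star_dotProduct_mulVec_conjTranspose (B : Matrix m n ℂ) (u : m → ℂ) :
    star u ⬝ᵥ ((B * Bᴴ) *ᵥ u) = (normSq (Bᴴ *ᵥ u) : ℂ) := by
  rw [← star_dotProduct_self, Matrix.star_mulVec, Matrix.conjTranspose_conjTranspose,
    ← Matrix.mulVec_mulVec, Matrix.dotProduct_mulVec]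

/-- `⟨u, Hᴴ H u⟩ = ‖H u‖²`. -/
lemma star_dotProduct_gram_mulVec (H : Matrix m n ℂ) (u : n → ℂ) :
    star u ⬝ᵥ ((Hᴴ * H) *ᵥ u) = (normSq (H *ᵥ u) : ℂ) := by
  simpa using star_dotProduct_mulVec_conjTranspose Hᴴ u

section Resolvent

variable [DecidableEq m] {a : ℝ} (B : Matrix m n ℂ)

lemma star_dotProduct_one_add_mulVec (u : m → ℂ) :
    star u ⬝ᵥ (((a : ℂ) • (B * Bᴴ) + 1) *ᵥ u)
      = ((normSq u + a * normSq (Bᴴ *ᵥ u) : ℝ) : ℂ) := by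
  rw [Matrix.add_mulVec, Matrix.smul_mulVec, Matrix.one_mulVec, dotProduct_add, dotProduct_smul,
    star_dotProduct_mulVec_conjTranspose, star_dotProduct_self]
  push_cast
  rw [smul_eq_mul, add_comm]

lemma isUnit_det_one_add (ha : 0 ≤ a) : IsUnit ((a : ℂ) • (B * Bᴴ) + 1).det := by
  rw [isUnit_iff_ne_zero]
  intro h
  obtain ⟨u, hu, hu0⟩ := Matrix.exists_mulVec_eq_zero_iff.2 h
  have h1 := star_dotProduct_one_add_mulVec (a := a) B u
  rw [hu0, dotProduct_zero] at h1
  have h2 : normSq u + a * normSq (Bᴴ *ᵥ u) = 0 := by exact_mod_cast h1.symm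
  have h3 := mul_nonneg ha (normSq_nonneg (Bᴴ *ᵥ u))
  exact hu (normSq_eq_zero (le_antisymm (by linarith) (normSq_nonneg u)))

/-- The quadratic form of the resolvent at `h`, expressed through `u = (a B Bᴴ + 1)⁻¹ h`. -/
lemma exists_resolvent (ha : 0 ≤ a) (h : m → ℂ) :
    ∃ u : m → ℂ, ((a : ℂ) • (B * Bᴴ) + 1) *ᵥ u = h ∧
      (star h ⬝ᵥ (((a : ℂ) • (B * Bᴴ) + 1)⁻¹ *ᵥ h)).re = normSq u + a * normSq (Bᴴ *ᵥ u) ∧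
      (star h ⬝ᵥ (((a : ℂ) • (B * Bᴴ) + 1)⁻¹ *ᵥ h)).re = (star h ⬝ᵥ u).re := by
  set A := (a : ℂ) • (B * Bᴴ) + 1 with hA
  have hu : A *ᵥ (A⁻¹ *ᵥ h) = h := by
    rw [Matrix.mulVec_mulVec, Matrix.mul_nonsing_inv _ (isUnit_det_one_add B ha),
      Matrix.one_mulVec]
  refine ⟨A⁻¹ *ᵥ h, hu, ?_, rfl⟩
  set u := A⁻¹ *ᵥ h
  have h1 := star_dotProduct_one_add_mulVec (a := a) B u
  rw [← hA, hu] at h1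
  have h2 : (star h ⬝ᵥ u).re = (star u ⬝ᵥ h).re := by
    rw [← Complex.conj_re (star u ⬝ᵥ h), ← RCLike.star_def, Matrix.star_dotProduct]
  rw [h2, h1, Complex.ofReal_re]

lemma resolvent_nonneg (ha : 0 ≤ a) (h : m → ℂ) :
    0 ≤ (star h ⬝ᵥ (((a : ℂ) • (B * Bᴴ) + 1)⁻¹ *ᵥ h)).re := by
  obtain ⟨u, -, h1, -⟩ := exists_resolvent B ha h
  rw [h1]
  have := normSq_nonneg u
  have := mul_nonneg ha (normSq_nonneg (Bᴴ *ᵥ u))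
  linarith

/-- The form `q` equals both `re ⟨h, u⟩` and `‖u‖² + a ‖Bᴴ u‖²`, so Cauchy–Schwarz yields `q² ≤ ‖h‖²
‖u‖² ≤ ‖h‖² q`. -/
lemma resolvent_le (ha : 0 ≤ a) (h : m → ℂ) :
    (star h ⬝ᵥ (((a : ℂ) • (B * Bᴴ) + 1)⁻¹ *ᵥ h)).re ≤ normSq h := by
  have h0 := resolvent_nonneg B ha h
  obtain ⟨u, -, h1, h2⟩ := exists_resolvent B ha h
  set q := (star h ⬝ᵥ (((a : ℂ) • (B * Bᴴ) + 1)⁻¹ *ᵥ h)).re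
  have h3 : q ≤ ‖star h ⬝ᵥ u‖ := h2.trans_le (Complex.re_le_norm _)
  have h4 := sq_norm_star_dotProduct_le h u
  have h5 := mul_nonneg ha (normSq_nonneg (Bᴴ *ᵥ u))
  have h6 : q ^ 2 ≤ normSq h * q := by
    calc q ^ 2 ≤ ‖star h ⬝ᵥ u‖ ^ 2 := by gcongr
      _ ≤ normSq h * normSq u := h4
      _ ≤ normSq h * q := by
        gcongr
        · exact normSq_nonneg h
        · linarith
  rcases h0.eq_or_lt with h7 | h7
  · rw [← h7]; exact normSq_nonneg h
  · nlinarith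

/-- Weak interference costs only a factor `1 + a β`, because the squared Frobenius norm `β` bounds
the operator norm of `B Bᴴ`. -/
lemma le_resolvent (ha : 0 ≤ a) (h : m → ℂ) {β : ℝ} (hβ : ∑ i, normSq (B i) ≤ β) :
    normSq h ≤ (1 + a * β) * (star h ⬝ᵥ (((a : ℂ) • (B * Bᴴ) + 1)⁻¹ *ᵥ h)).re := by
  obtain ⟨u, hu, h1, -⟩ := exists_resolvent B ha h
  rw [h1]
  set w := Bᴴ *ᵥ u with hw
  have hB : ∑ i, normSq (Bᴴ i) = ∑ i, normSq (B i) := by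
    simp only [normSq, Matrix.conjTranspose_apply, norm_star]
    exact Finset.sum_comm
  have h2 : normSq w ≤ β * normSq u := by
    refine (normSq_mulVec_le Bᴴ u).trans ?_
    rw [hB]
    exact mul_le_mul_of_nonneg_right hβ (normSq_nonneg u)
  have h3 : normSq (B *ᵥ w) ≤ β * normSq w :=
    (normSq_mulVec_le B w).trans (mul_le_mul_of_nonneg_right hβ (normSq_nonneg w))
  have h4 : normSq h = normSq u + 2 * a * normSq w + a ^ 2 * normSq (B *ᵥ w) := by
    have e1 : h = u + (a : ℂ) • (B *ᵥ w) := by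
      rw [← hu, Matrix.add_mulVec, Matrix.smul_mulVec, Matrix.one_mulVec, hw,
        Matrix.mulVec_mulVec, add_comm]
    have e2 : star u ⬝ᵥ (B *ᵥ w) = (normSq w : ℂ) := by
      rw [hw, Matrix.mulVec_mulVec, star_dotProduct_mulVec_conjTranspose]
    have e3 : star (B *ᵥ w) ⬝ᵥ u = (normSq w : ℂ) := by
      rw [← star_star (star (B *ᵥ w) ⬝ᵥ u), Matrix.star_dotProduct, star_star, e2]
      simp
    have e4 : (normSq h : ℂ)
        = ((normSq u + 2 * a * normSq w + a ^ 2 * normSq (B *ᵥ w) : ℝ) : ℂ) := by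
      rw [← star_dotProduct_self, e1, star_add, star_smul, add_dotProduct, dotProduct_add,
        dotProduct_add, smul_dotProduct, smul_dotProduct, dotProduct_smul, dotProduct_smul,
        star_dotProduct_self, star_dotProduct_self, e2, e3]
      simp only [RCLike.star_def, Complex.conj_ofReal, smul_eq_mul]
      push_cast
      ring
    exact_mod_cast e4
  rw [h4]
  -- The difference of the two sides is `a (β ‖u‖² - ‖w‖²) + a² (β ‖w‖² - ‖B w‖²)`.
  nlinarith [mul_le_mul_of_nonneg_left h2 ha, mul_le_mul_of_nonneg_left h3 (sq_nonneg a)]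

end Resolvent

variable [DecidableEq n] (H : Matrix m n ℂ) (k : n)

/-- For invertible Gram matrix, `u = (Hᴴ H)⁻¹ eₖ` satisfies `uₖ = ‖H u‖²` and `⟨hₖ, H u⟩ = 1`. -/
lemma exists_gram_inverse (hG : IsUnit (Hᴴ * H).det) :
    ∃ u : n → ℂ, u k = (normSq (H *ᵥ u) : ℂ) ∧ u k = (Hᴴ * H)⁻¹ k k ∧
      star (H.col k) ⬝ᵥ (H *ᵥ u) = 1 := by
  set G := Hᴴ * H with hGdef
  have hu : G *ᵥ (G⁻¹ *ᵥ Pi.single k 1) = Pi.single k 1 := by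
    rw [Matrix.mulVec_mulVec, Matrix.mul_nonsing_inv _ hG, Matrix.one_mulVec]
  refine ⟨G⁻¹ *ᵥ Pi.single k 1, ?_, by simp, ?_⟩
  · set u := G⁻¹ *ᵥ Pi.single k 1
    have h1 := star_dotProduct_gram_mulVec H u
    rw [← hGdef, hu] at h1
    simp only [dotProduct_single, mul_one, Pi.star_apply] at h1
    rw [← star_star (u k), h1]
    simp
  · set u := G⁻¹ *ᵥ Pi.single k 1
    have h1 := congrFun hu k
    rw [hGdef, ← Matrix.mulVec_mulVec, Pi.single_eq_same] at h1
    exact h1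

lemma gram_inverse_nonneg : 0 ≤ ((Hᴴ * H)⁻¹ k k).re := by
  by_cases hG : IsUnit (Hᴴ * H).det
  · obtain ⟨u, h1, h2, -⟩ := exists_gram_inverse H k hG
    rw [← h2, h1, Complex.ofReal_re]
    exact normSq_nonneg _
  · rw [Matrix.nonsing_inv_apply_not_isUnit _ hG]
    simp

/-- Cauchy–Schwarz applied to `⟨hₖ, H u⟩ = 1`, where `‖H u‖²` is the diagonal entry. -/
lemma inv_gram_inverse_le : (((Hᴴ * H)⁻¹ k k).re)⁻¹ ≤ normSq (H.col k) := by
  by_cases hG : IsUnit (Hᴴ * H).det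
  · obtain ⟨u, h1, h2, h3⟩ := exists_gram_inverse H k hG
    rw [← h2, h1, Complex.ofReal_re]
    have h4 := sq_norm_star_dotProduct_le (H.col k) (H *ᵥ u)
    rw [h3] at h4
    simp only [norm_one, one_pow] at h4
    have h5 : 0 < normSq (H *ᵥ u) := by
      rcases (normSq_nonneg (H *ᵥ u)).eq_or_lt with h | h
      · rw [← h] at h4; norm_num at h4
      · exact h
    rw [inv_le_iff_one_le_mul₀ h5]
    exact h4
  -- A singular Gram matrix has inverse `0` by convention, and the reciprocal of the entry is again
  -- `0`.
  · rw [Matrix.nonsing_inv_apply_not_isUnit _ hG]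
    simpa using normSq_nonneg _

/-- The reciprocal of a diagonal entry of the inverse Gram matrix is `‖H w‖²` for some `w` with
`wₖ = 1`. -/
lemma le_inv_gram_inverse {t : ℝ} (hH : ∀ w, H *ᵥ w = 0 → w = 0)
    (ht : ∀ w : n → ℂ, w k = 1 → t ≤ normSq (H *ᵥ w)) :
    t ≤ (((Hᴴ * H)⁻¹ k k).re)⁻¹ := by
  have hG : IsUnit (Hᴴ * H).det := by
    rw [isUnit_iff_ne_zero]
    intro h
    obtain ⟨u, hu, hu0⟩ := Matrix.exists_mulVec_eq_zero_iff.2 h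
    have h1 := star_dotProduct_gram_mulVec H u
    rw [hu0, dotProduct_zero] at h1
    exact hu (hH u (normSq_eq_zero (by exact_mod_cast h1.symm)))
  obtain ⟨u, h1, h2, h3⟩ := exists_gram_inverse H k hG
  rw [← h2, h1, Complex.ofReal_re]
  set g := normSq (H *ᵥ u) with hg
  have hg0 : g ≠ 0 := by
    intro h
    rw [normSq_eq_zero h, dotProduct_zero] at h3
    exact zero_ne_one h3
  have h4 := ht ((g : ℂ)⁻¹ • u) (by simp [h1, hg0])
  rw [Matrix.mulVec_smul] at h4
  refine h4.trans_eq ?_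
  have : normSq ((g : ℂ)⁻¹ • (H *ᵥ u)) = (g⁻¹) ^ 2 * g := by
    rw [hg, normSq, normSq, Finset.mul_sum]
    refine Finset.sum_congr rfl fun i _ => ?_
    rw [Pi.smul_apply, smul_eq_mul, norm_mul, mul_pow, norm_inv, Complex.norm_real,
      Real.norm_of_nonneg (Finset.sum_nonneg fun _ _ => sq_nonneg _)]
  rw [this]
  field_simp

end DotProduct

/-! ### Comparison of the SINRs with the column energy -/

section SinrBounds

variable {Nr Nt : ℕ} {ρ : ℝ} (H : Matrix (Fin Nr) (Fin Nt) ℂ) (k : Fin Nt)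

lemma sinrMRC_nonneg (hρ : 0 < ρ) : 0 ≤ sinrMRC ρ H k := by
  unfold sinrMRC; positivity

lemma sinrMRC_le (hρ : 0 < ρ) : sinrMRC ρ H k ≤ ρ / Nt * normSq (H.col k) := by
  unfold sinrMRC
  rw [norm_star_dotProduct_self]
  have hq := normSq_nonneg (H.col k)
  have hs : 0 ≤ ρ / Nt * ∑ j ∈ Finset.univ.erase k, ‖star (H.col k) ⬝ᵥ H.col j‖ ^ 2 := by positivity
  have ha : 0 ≤ ρ / Nt := by positivity
  refine div_le_of_le_mul₀ (by positivity) (by positivity) ?_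
  nlinarith [mul_nonneg (mul_nonneg ha hq) hs]

lemma le_sinrMRC (hρ : 0 < ρ) {β : ℝ}
    (hβ : ∑ j ∈ Finset.univ.erase k, normSq (H.col j) ≤ β) :
    ρ / Nt * normSq (H.col k) ≤ (1 + ρ / Nt * β) * sinrMRC ρ H k := by
  unfold sinrMRC
  rw [norm_star_dotProduct_self]
  set q := normSq (H.col k) with hqdef
  have hq : 0 ≤ q := normSq_nonneg (H.col k)
  have ha : 0 ≤ ρ / Nt := by positivity
  set s := ∑ j ∈ Finset.univ.erase k, ‖star (H.col k) ⬝ᵥ H.col j‖ ^ 2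
  have hs0 : 0 ≤ s := by positivity
  have hs : s ≤ q * β := by
    calc s ≤ ∑ j ∈ Finset.univ.erase k, q * normSq (H.col j) :=
          Finset.sum_le_sum fun j _ => sq_norm_star_dotProduct_le _ _
      _ = q * ∑ j ∈ Finset.univ.erase k, normSq (H.col j) := by rw [Finset.mul_sum]
      _ ≤ q * β := by gcongr
  -- For a zero column the SINR is `0 / 0 = 0`, and both sides vanish.
  rcases hq.eq_or_lt with h0 | h0
  · rw [← h0]; simp
  · have hd : 0 < ρ / Nt * s + q := by positivity
    rw [← mul_div_assoc, le_div_iff₀ hd]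
    nlinarith [mul_le_mul_of_nonneg_left hs (mul_nonneg (mul_nonneg ha ha) hq)]

lemma sinrMMSE_nonneg (hρ : 0 < ρ) : 0 ≤ sinrMMSE ρ H k :=
  mul_nonneg (by positivity) (resolvent_nonneg (removeCol H k) (by positivity) _)

lemma sinrMMSE_le (hρ : 0 < ρ) : sinrMMSE ρ H k ≤ ρ / Nt * normSq (H.col k) :=
  mul_le_mul_of_nonneg_left (resolvent_le (removeCol H k) (by positivity) _) (by positivity)

lemma le_sinrMMSE (hρ : 0 < ρ) {β : ℝ}
    (hβ : ∑ j ∈ Finset.univ.erase k, normSq (H.col j) ≤ β) :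
    ρ / Nt * normSq (H.col k) ≤ (1 + ρ / Nt * β) * sinrMMSE ρ H k := by
  have h1 : ∑ i, normSq (removeCol H k i) ≤ β := by
    refine le_of_eq_of_le ?_ hβ
    simp only [normSq, removeCol, Matrix.submatrix_apply, id, Matrix.col_apply]
    rw [Finset.sum_comm]
    rw [← Finset.sum_subtype (p := fun j => j ≠ k) (Finset.univ.erase k) (by simp)
      (fun j => ∑ i, ‖H i j‖ ^ 2)]
  have h2 := le_resolvent (removeCol H k) (a := ρ / Nt) (by positivity) (H.col k) h1
  have h3 := mul_le_mul_of_nonneg_left h2 (show 0 ≤ ρ / Nt by positivity)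
  unfold sinrMMSE
  linarith

lemma sinrZF_eq : sinrZF ρ H k = ρ / Nt * (((Hᴴ * H)⁻¹ k k).re)⁻¹ := by
  rw [sinrZF, div_mul_eq_div_div, div_eq_mul_inv (ρ / Nt)]

lemma sinrZF_nonneg (hρ : 0 < ρ) : 0 ≤ sinrZF ρ H k := by
  rw [sinrZF_eq]
  exact mul_nonneg (by positivity) (inv_nonneg.2 (gram_inverse_nonneg H k))

lemma sinrZF_le (hρ : 0 < ρ) : sinrZF ρ H k ≤ ρ / Nt * normSq (H.col k) := by
  rw [sinrZF_eq]
  exact mul_le_mul_of_nonneg_left (inv_gram_inverse_le H k) (by positivity)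

lemma sinr_nonneg (r : Receiver) (hρ : 0 < ρ) : 0 ≤ sinr r ρ H k := by
  cases r
  exacts [sinrMRC_nonneg H k hρ, sinrZF_nonneg H k hρ, sinrMMSE_nonneg H k hρ]

lemma sinr_le (r : Receiver) (hρ : 0 < ρ) : sinr r ρ H k ≤ ρ / Nt * normSq (H.col k) := by
  cases r
  exacts [sinrMRC_le H k hρ, sinrZF_le H k hρ, sinrMMSE_le H k hρ]

end SinrBounds

/-! ### Channel matrices with large SINR -/

section Box

variable {Nr Nt : ℕ} {ρ : ℝ}

/-- The channel matrices whose real and imaginary parts are entrywise `δ`-close to the real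
matrix `Y`. -/
def box (Y : Fin Nr → Fin Nt → ℝ) (δ : ℝ) : Set (Fin Nr → Fin Nt → ℂ) :=
  {H | ∀ i j, |(H i j).re - Y i j| ≤ δ ∧ |(H i j).im| ≤ δ}

lemma norm_sub_le_of_mem_box {Y : Fin Nr → Fin Nt → ℝ} {δ : ℝ} {H : Fin Nr → Fin Nt → ℂ}
    (h : H ∈ box Y δ) (i : Fin Nr) (j : Fin Nt) : ‖H i j - Y i j‖ ≤ 2 * δ := by
  have h1 := Complex.norm_le_abs_re_add_abs_im (H i j - Y i j)
  simp only [Complex.sub_re, Complex.ofReal_re, Complex.sub_im, Complex.ofReal_im, sub_zero] at h1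
  linarith [h i j]

/-- A SINR that is at least `a ‖hₖ‖² / (1 + a β)`, with `β` the energy of the interfering columns,
is large on the box around the matrix with a single non-zero entry. -/
lemma le_on_box_of_interference (hNt : 1 ≤ Nt) (k : Fin Nt) (i₀ : Fin Nr) (hρ : 0 < ρ)
    {y γ : ℝ} (hy : 1 ≤ y) (hγ0 : 0 ≤ γ) {H : Fin Nr → Fin Nt → ℂ}
    (hH : H ∈ box (fun i j => if i = i₀ ∧ j = k then y else 0) (1 / y ^ 2))
    (hγ : ∀ β, ∑ j ∈ Finset.univ.erase k, normSq ((Matrix.of H).col j) ≤ β →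
      ρ / Nt * normSq ((Matrix.of H).col k) ≤ (1 + ρ / Nt * β) * γ) :
    ρ / Nt * (y ^ 2 - (4 + 4 * (ρ / Nt) * (Nt * Nr))) ≤ γ := by
  have ha : 0 < ρ / Nt := by positivity
  set a := ρ / Nt
  have hy2 : 1 ≤ y ^ 2 := by nlinarith
  have hβ : ∑ j ∈ Finset.univ.erase k, normSq ((Matrix.of H).col j)
      ≤ Nt * Nr * (4 / y ^ 2) := by
    calc ∑ j ∈ Finset.univ.erase k, normSq ((Matrix.of H).col j)
        ≤ ∑ j ∈ Finset.univ.erase k, (Nr * (4 / y ^ 2) : ℝ) := by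
          refine Finset.sum_le_sum fun j hj => ?_
          have hjk : j ≠ k := Finset.ne_of_mem_erase hj
          calc normSq ((Matrix.of H).col j) ≤ ∑ _i : Fin Nr, (4 / y ^ 2 : ℝ) := by
                refine Finset.sum_le_sum fun i _ => ?_
                have h1 := norm_sub_le_of_mem_box hH i j
                simp only [hjk, and_false, if_false, Complex.ofReal_zero, sub_zero] at h1
                rw [Matrix.col_apply, Matrix.of_apply]
                calc ‖H i j‖ ^ 2 ≤ (2 * (1 / y ^ 2)) ^ 2 := by gcongr
                  _ = 4 / y ^ 2 * (1 / y ^ 2) := by ring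
                  _ ≤ 4 / y ^ 2 * 1 := by
                    gcongr
                    rw [div_le_one (by positivity)]; exact hy2
                  _ = 4 / y ^ 2 := mul_one _
            _ = Nr * (4 / y ^ 2) := by simp
      _ ≤ ∑ j : Fin Nt, (Nr * (4 / y ^ 2) : ℝ) :=
          Finset.sum_le_sum_of_subset_of_nonneg (Finset.erase_subset _ _)
            fun _ _ _ => by positivity
      _ = Nt * Nr * (4 / y ^ 2) := by simp [mul_assoc]
  have hq : y ^ 2 - 4 ≤ normSq ((Matrix.of H).col k) := by
    have h1 := norm_sub_le_of_mem_box hH i₀ k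
    simp only [and_self, if_true] at h1
    have h2 : y - 2 * (1 / y ^ 2) ≤ ‖H i₀ k‖ := by
      have h3 := norm_sub_norm_le (y : ℂ) ((y : ℂ) - H i₀ k)
      rw [sub_sub_cancel, norm_sub_rev, Complex.norm_real, Real.norm_of_nonneg (by linarith)] at h3
      linarith
    have h4 : (1 / y ^ 2) * y ≤ 1 := by
      rw [div_mul_eq_mul_div, one_mul, div_le_one (by positivity)]
      nlinarith
    have h5 := sq_norm_le_normSq ((Matrix.of H).col k) i₀
    rw [Matrix.col_apply, Matrix.of_apply] at h5
    nlinarith [norm_nonneg (H i₀ k), sq_nonneg (‖H i₀ k‖ - y)]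
  have h1 := hγ _ hβ
  rcases le_or_gt (y ^ 2 - (4 + 4 * a * (Nt * Nr))) 0 with h2 | h2
  · exact (mul_nonpos_of_nonneg_of_nonpos ha.le h2).trans hγ0
  · have hP : 0 < 1 + a * (Nt * Nr * (4 / y ^ 2)) := by positivity
    refine le_of_mul_le_mul_left ?_ hP
    refine le_trans ?_ h1
    rw [mul_left_comm]
    refine mul_le_mul_of_nonneg_left (le_trans ?_ hq) ha.le
    -- With `C = 4 + 4 a Nt Nr` and `β = 4 Nt Nr / y²`, one has `(y² - C) (1 + a β) ≤ y² - C + a β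
    -- y² = y² - 4`.
    have h3 : (y ^ 2 - (4 + 4 * a * (Nt * Nr))) * (a * (Nt * Nr * (4 / y ^ 2)))
        ≤ y ^ 2 * (a * (Nt * Nr * (4 / y ^ 2))) := by
      refine mul_le_mul_of_nonneg_right ?_ (by positivity)
      have : 0 ≤ 4 * a * (Nt * Nr) := by positivity
      linarith
    have h4 : y ^ 2 * (a * (Nt * Nr * (4 / y ^ 2))) = 4 * a * (Nt * Nr) := by
      field_simp
    linarith

/-- The zero-forcing SINR is large on the box around the matrix with orthogonal columns
`e_{ι j}` for `j ≠ k` and `y e_{ι k}`. -/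
lemma le_sinrZF_on_box (hNt : 1 ≤ Nt) (k : Fin Nt) (ι : Fin Nt ↪ Fin Nr) (hρ : 0 < ρ)
    {y : ℝ} (hy : 1 ≤ y) (hyN : 8 * Nt + 8 ≤ y ^ 2) {H : Fin Nr → Fin Nt → ℂ}
    (hH : H ∈ box (fun i j => if i = ι j then (if j = k then y else 1) else 0) (1 / y ^ 2)) :
    ρ / Nt * (y ^ 2 - (8 * Nt + 8)) ≤ sinrZF ρ (Matrix.of H) k := by
  rw [sinrZF_eq]
  refine mul_le_mul_of_nonneg_left ?_ (by positivity)
  set δ := 1 / y ^ 2 with hδ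
  have hy2 : 1 ≤ y ^ 2 := by nlinarith
  have hδ0 : 0 < δ := by positivity
  have hδy : δ * y ^ 2 = 1 := by rw [hδ]; field_simp
  have hNt1 : (1 : ℝ) ≤ Nt := by exact_mod_cast hNt
  have hNδ : 4 * Nt * δ ≤ 1 := by nlinarith
  -- each coordinate of `H w` is a perturbation of the corresponding coordinate of `w`
  have key : ∀ (w : Fin Nt → ℂ) (j : Fin Nt),
      (if j = k then y else 1) * ‖w j‖ - 2 * δ * ∑ l, ‖w l‖ ≤ ‖(Matrix.of H *ᵥ w) (ι j)‖ := by
    intro w j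
    set Y : Fin Nr → Fin Nt → ℝ := fun i j => if i = ι j then (if j = k then y else 1) else 0
    have e1 : ∑ l, (Y (ι j) l : ℂ) * w l = ((if j = k then y else 1 : ℝ) : ℂ) * w j := by
      rw [Finset.sum_eq_single j]
      · simp [Y]
      · intro l _ hl
        simp [Y, hl.symm]
      · simp
    have e2 : (Matrix.of H *ᵥ w) (ι j)
        = ((if j = k then y else 1 : ℝ) : ℂ) * w j - ∑ l, (Y (ι j) l - H (ι j) l) * w l := by
      rw [← e1, ← Finset.sum_sub_distrib]
      change ∑ l, H (ι j) l * w l = _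
      exact Finset.sum_congr rfl fun l _ => by ring
    have e3 : ‖∑ l, (Y (ι j) l - H (ι j) l) * w l‖ ≤ 2 * δ * ∑ l, ‖w l‖ := by
      rw [Finset.mul_sum]
      refine (norm_sum_le _ _).trans (Finset.sum_le_sum fun l _ => ?_)
      rw [norm_mul, norm_sub_rev]
      exact mul_le_mul_of_nonneg_right (norm_sub_le_of_mem_box hH _ _) (norm_nonneg _)
    have e4 := norm_sub_norm_le (((if j = k then y else 1 : ℝ) : ℂ) * w j)
      (∑ l, (Y (ι j) l - H (ι j) l) * w l)
    rw [← e2, norm_mul, Complex.norm_real, Real.norm_of_nonneg (by split_ifs <;> linarith)] at e4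
    linarith
  have key1 : ∀ (w : Fin Nt → ℂ) (j : Fin Nt),
      ‖w j‖ - 2 * δ * ∑ l, ‖w l‖ ≤ ‖(Matrix.of H *ᵥ w) (ι j)‖ := by
    intro w j
    refine le_trans ?_ (key w j)
    have : 1 ≤ (if j = k then y else 1) := by split_ifs <;> linarith
    nlinarith [norm_nonneg (w j)]
  refine le_inv_gram_inverse _ k (fun w hw => ?_) (fun w hw => ?_)
  · have h1 : ∑ l, ‖w l‖ ≤ ∑ _l : Fin Nt, 2 * δ * ∑ l, ‖w l‖ := by
      refine Finset.sum_le_sum fun j _ => ?_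
      have := key1 w j
      rw [hw, Pi.zero_apply, norm_zero] at this
      linarith
    simp only [Finset.sum_const, Finset.card_univ, Fintype.card_fin, nsmul_eq_mul] at h1
    have h0 : 0 ≤ ∑ l, ‖w l‖ := by positivity
    have h2 : ∑ l, ‖w l‖ = 0 := by nlinarith
    rw [Finset.sum_eq_zero_iff_of_nonneg fun _ _ => norm_nonneg _] at h2
    ext l
    simpa using h2 l (Finset.mem_univ l)
  -- If `‖H w‖² < y²`, every coordinate of `H w` is below `y`. Since `4 Nt δ ≤ 1`, this forces `T =
  -- ∑ ‖w l‖ ≤ 2 Nt y`. Then `g ≥ y - 2 δ T` with `δ T y ≤ 2 Nt`, and `g² ≥ 2 g y - y² ≥ y² - 8 Nt`.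
  · rcases le_or_gt (y ^ 2) (normSq (Matrix.of H *ᵥ w)) with h | h
    · have : (0 : ℝ) ≤ 8 * Nt + 8 := by positivity
      linarith
    have hlt : ∀ i, ‖(Matrix.of H *ᵥ w) i‖ < y := fun i =>
      lt_of_pow_lt_pow_left₀ 2 (by linarith) ((sq_norm_le_normSq _ i).trans_lt h)
    have h1 : ∑ l, ‖w l‖ ≤ ∑ _l : Fin Nt, (y + 2 * δ * ∑ l, ‖w l‖) := by
      refine Finset.sum_le_sum fun j _ => ?_
      linarith [key1 w j, hlt (ι j)]
    simp only [Finset.sum_const, Finset.card_univ, Fintype.card_fin, nsmul_eq_mul] at h1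
    have h0 : 0 ≤ ∑ l, ‖w l‖ := by positivity
    set T := ∑ l, ‖w l‖
    have hT : T ≤ 2 * Nt * y := by nlinarith
    have h2 := key w k
    rw [hw] at h2
    simp only [if_true, norm_one, mul_one] at h2
    have h3 := sq_norm_le_normSq (Matrix.of H *ᵥ w) (ι k)
    have h4 : δ * T * y ≤ 2 * Nt := by
      calc δ * T * y ≤ δ * (2 * Nt * y) * y := by gcongr
        _ = 2 * Nt * (δ * y ^ 2) := by ring
        _ = 2 * Nt := by rw [hδy, mul_one]
    set g := ‖(Matrix.of H *ᵥ w) (ι k)‖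
    have hg : 0 ≤ g := norm_nonneg _
    nlinarith [sq_nonneg (g - y)]

/-- Every receiver attains a SINR of at least `(ρ / Nt) (y² - C)` on a small box around a matrix
of energy at most `y² + Nt`. -/
lemma exists_box_le_sinr (r : Receiver) (hNr : 1 ≤ Nr) (hNt : 1 ≤ Nt)
    (hZF : r = Receiver.ZF → Nt ≤ Nr) (hρ : 0 < ρ) (k : Fin Nt) :
    ∃ C : ℝ, 0 ≤ C ∧ ∀ y : ℝ, 1 ≤ y → C ≤ y ^ 2 → ∃ Y : Fin Nr → Fin Nt → ℝ,
      ∑ i, ∑ j, Y i j ^ 2 ≤ y ^ 2 + Nt ∧ (∀ i j, |Y i j| ≤ y) ∧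
      ∀ H ∈ box Y (1 / y ^ 2), ρ / Nt * (y ^ 2 - C) ≤ sinr r ρ (Matrix.of H) k := by
  have hsingle : (r = .MRC ∨ r = .MMSE) → ∃ C : ℝ, 0 ≤ C ∧ ∀ y : ℝ, 1 ≤ y → C ≤ y ^ 2 →
      ∃ Y : Fin Nr → Fin Nt → ℝ,
      ∑ i, ∑ j, Y i j ^ 2 ≤ y ^ 2 + Nt ∧ (∀ i j, |Y i j| ≤ y) ∧
      ∀ H ∈ box Y (1 / y ^ 2), ρ / Nt * (y ^ 2 - C) ≤ sinr r ρ (Matrix.of H) k := by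
    intro hr
    refine ⟨4 + 4 * (ρ / Nt) * (Nt * Nr), by positivity, fun y hy _ =>
      ⟨fun i j => if i = ⟨0, hNr⟩ ∧ j = k then y else 0, ?_, ?_, fun H hH => ?_⟩⟩
    · have : ∑ i : Fin Nr, ∑ j : Fin Nt, (if i = ⟨0, hNr⟩ ∧ j = k then y else 0) ^ 2 = y ^ 2 := by
        rw [Finset.sum_eq_single ⟨0, hNr⟩, Finset.sum_eq_single k]
        · simp
        · intro j _ hj; simp [hj]
        · simp
        · intro i _ hi; simp [hi]
        · simp
      rw [this]
      exact le_add_of_nonneg_right (Nat.cast_nonneg _)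
    · intro i j
      dsimp only
      split_ifs
      · rw [abs_of_nonneg (by linarith)]
      · rw [abs_zero]; linarith
    · refine le_on_box_of_interference hNt k ⟨0, hNr⟩ hρ hy (sinr_nonneg _ k r hρ) hH ?_
      intro β hβ
      rcases hr with rfl | rfl
      · exact le_sinrMRC _ k hρ hβ
      · exact le_sinrMMSE _ k hρ hβ
  cases r with
  | MRC => exact hsingle (Or.inl rfl)
  | MMSE => exact hsingle (Or.inr rfl)
  | ZF =>
    let ι : Fin Nt ↪ Fin Nr := Fin.castLEEmb (hZF rfl)
    refine ⟨8 * Nt + 8, by positivity, fun y hy hyN =>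
      ⟨fun i j => if i = ι j then (if j = k then y else 1) else 0, ?_, ?_, fun H hH =>
        le_sinrZF_on_box hNt k ι hρ hy hyN hH⟩⟩
    · rw [Finset.sum_comm]
      have : ∀ j : Fin Nt, ∑ i : Fin Nr,
          (if i = ι j then (if j = k then y else 1) else 0 : ℝ) ^ 2
            ≤ (if j = k then y ^ 2 else 0) + 1 := by
        intro j
        rw [Finset.sum_eq_single (ι j)]
        · split_ifs <;> simp_all
        · intro i _ hi; simp [hi]
        · simp
      refine (Finset.sum_le_sum fun j _ => this j).trans ?_
      rw [Finset.sum_add_distrib]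
      simp
    · intro i j
      dsimp only
      split_ifs
      · rw [abs_of_nonneg (by linarith)]
      · rw [abs_one]; exact hy
      · rw [abs_zero]; linarith

end Box

/-! ### Measurability of the SINRs -/

section Measurability

/-- Inversion is not continuous at singular matrices, but `det⁻¹ • adjugate` is measurable and also
gives the default value `0` there. -/
lemma measurable_nonsing_inv_apply {X n : Type*} [TopologicalSpace X] [MeasurableSpace X]
    [BorelSpace X] [Fintype n] [DecidableEq n] {A : X → Matrix n n ℂ} (hA : Continuous A)
    (i j : n) : Measurable fun x => (A x)⁻¹ i j := by
  have : (fun x => (A x)⁻¹ i j) = fun x => (A x).det⁻¹ * (A x).adjugate i j := by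
    ext x
    rw [Matrix.inv_def, Matrix.smul_apply, Ring.inverse_eq_inv', smul_eq_mul]
  rw [this]
  exact hA.matrix_det.measurable.inv.mul (hA.matrix_adjugate.matrix_elem i j).measurable

lemma measurable_sinr {Nr Nt : ℕ} (r : Receiver) (ρ : ℝ) (k : Fin Nt) :
    Measurable fun H : Fin Nr → Fin Nt → ℂ => sinr r ρ (Matrix.of H) k := by
  have hof : Continuous fun H : Fin Nr → Fin Nt → ℂ => Matrix.of H := continuous_id
  have hcol : ∀ j, Continuous fun H : Fin Nr → Fin Nt → ℂ => (Matrix.of H).col j := fun j =>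
    continuous_pi fun i => hof.matrix_elem i j
  cases r with
  | MRC =>
    have h : ∀ j, Continuous fun H : Fin Nr → Fin Nt → ℂ =>
        ‖star ((Matrix.of H).col k) ⬝ᵥ (Matrix.of H).col j‖ := fun j =>
      ((hcol k).star.dotProduct (hcol j)).norm
    exact (((h k).pow 2).const_mul _).measurable.div
      (((continuous_finsetSum _ fun j _ => (h j).pow 2).const_mul _).add (h k)).measurable
  | ZF =>
    exact measurable_const.div (measurable_const.mul (Complex.measurable_re.comp
      (measurable_nonsing_inv_apply (hof.matrix_conjTranspose.matrix_mul hof) k k)))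
  | MMSE =>
    have hB : Continuous fun H : Fin Nr → Fin Nt → ℂ => removeCol (Matrix.of H) k :=
      hof.matrix_submatrix _ _
    have hA : Continuous fun H : Fin Nr → Fin Nt → ℂ => ((ρ / Nt : ℝ) : ℂ) •
        (removeCol (Matrix.of H) k * (removeCol (Matrix.of H) k)ᴴ) + 1 :=
      ((hB.matrix_mul hB.matrix_conjTranspose).const_smul ((ρ / Nt : ℝ) : ℂ)).add
        (continuous_const (y := (1 : Matrix (Fin Nr) (Fin Nr) ℂ)))
    refine measurable_const.mul (Complex.measurable_re.comp ?_)
    simp only [dotProduct, Matrix.mulVec]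
    refine Finset.measurable_sum _ fun i _ => Measurable.mul ?_ ?_
    · exact ((continuous_apply i).comp (hcol k).star).measurable
    · refine Finset.measurable_sum _ fun j _ => Measurable.mul ?_ ?_
      · exact measurable_nonsing_inv_apply hA i j
      · exact ((continuous_apply j).comp (hcol k)).measurable

end Measurability

/-! ### Gaussian small-interval bounds and exponential moments -/

section Gaussian

/-- The density `exp (-x²) / √π` is at least `exp (-x²) / 2`, as `π ≤ 4`. On the interval `x² = c² +
2 c (x - c) + (x - c)² ≤ c² + 3`, and the length is `2 δ`. -/
lemma le_gaussianReal_Icc {c δ : ℝ} (hδ1 : δ ≤ 1) (hc : |c| * δ ≤ 1) :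
    δ * Real.exp (-3) * Real.exp (-c ^ 2)
      ≤ (gaussianReal 0 (1 / 2)).real (Set.Icc (c - δ) (c + δ)) := by
  have hv : (1 / 2 : NNReal) ≠ 0 := by norm_num
  have hpdf : ∀ x ∈ Set.Icc (c - δ) (c + δ),
      1 / 2 * Real.exp (-c ^ 2 - 3) ≤ gaussianPDFReal 0 (1 / 2) x := by
    intro x hx
    rw [gaussianPDFReal]
    push_cast
    refine mul_le_mul ?_ ?_ (Real.exp_pos _).le (by positivity)
    · rw [one_div]
      refine inv_anti₀ (by positivity) ?_
      rw [Real.sqrt_le_left (by norm_num)]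
      linarith [Real.pi_le_four]
    · rw [Real.exp_le_exp]
      have h1 : |x - c| ≤ δ := abs_le.2 ⟨by linarith [hx.1], by linarith [hx.2]⟩
      have h2 : c * (x - c) ≤ 1 := by
        calc c * (x - c) ≤ |c * (x - c)| := le_abs_self _
          _ = |c| * |x - c| := abs_mul _ _
          _ ≤ |c| * δ := by gcongr
          _ ≤ 1 := hc
      have h3 : (x - c) ^ 2 ≤ 1 := by
        rw [← sq_abs]
        exact pow_le_one₀ (abs_nonneg _) (h1.trans hδ1)
      have h4 : x ^ 2 ≤ c ^ 2 + 3 := by nlinarith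
      norm_num
      linarith
  have h1 : ENNReal.ofReal (δ * Real.exp (-3) * Real.exp (-c ^ 2))
      ≤ gaussianReal 0 (1 / 2) (Set.Icc (c - δ) (c + δ)) := by
    rw [gaussianReal_apply _ hv]
    calc ENNReal.ofReal (δ * Real.exp (-3) * Real.exp (-c ^ 2))
        = ∫⁻ _ in Set.Icc (c - δ) (c + δ), ENNReal.ofReal (1 / 2 * Real.exp (-c ^ 2 - 3)) := by
          rw [setLIntegral_const, Real.volume_Icc, ← ENNReal.ofReal_mul (by positivity),
            sub_eq_add_neg (-c ^ 2), Real.exp_add]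
          congr 1
          ring
      _ ≤ _ := setLIntegral_mono (measurable_gaussianPDF _ _) fun x hx =>
          ENNReal.ofReal_le_ofReal (hpdf x hx)
  rw [measureReal_def]
  exact (ENNReal.ofReal_le_iff_le_toReal (measure_ne_top _ _)).1 h1

lemma integral_exp_sq_gaussianReal {s : ℝ} (hs : s < 1) :
    ∫ x, Real.exp (s * x ^ 2) ∂(gaussianReal 0 (1 / 2)) = √(1 / (1 - s)) := by
  rw [integral_gaussianReal_eq_integral_smul (by norm_num)]
  have h : ∀ x : ℝ, gaussianPDFReal 0 (1 / 2) x • Real.exp (s * x ^ 2)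
      = (√Real.pi)⁻¹ * Real.exp (-(1 - s) * x ^ 2) := by
    intro x
    rw [gaussianPDFReal, smul_eq_mul, mul_assoc, ← Real.exp_add]
    push_cast
    congr 2
    · congr 1; ring
    · ring
  simp_rw [h]
  rw [integral_const_mul, integral_gaussian, ← Real.sqrt_inv, ← Real.sqrt_mul (by positivity)]
  congr 1
  have := Real.pi_pos
  have : 0 < 1 - s := by linarith
  field_simp

lemma stdComplexGaussian_eq : stdComplexGaussian
    = ((gaussianReal 0 (1 / 2)).prod (gaussianReal 0 (1 / 2))).map
      Complex.measurableEquivRealProd.symm := rfl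

lemma integral_exp_normSq_stdComplexGaussian {s : ℝ} (hs : s < 1) :
    ∫ z, Real.exp (s * ‖z‖ ^ 2) ∂stdComplexGaussian = 1 / (1 - s) := by
  rw [stdComplexGaussian_eq, integral_map_equiv]
  have h : ∀ p : ℝ × ℝ, Real.exp (s * ‖Complex.measurableEquivRealProd.symm p‖ ^ 2)
      = Real.exp (s * p.1 ^ 2) * Real.exp (s * p.2 ^ 2) := by
    intro p
    rw [← Real.exp_add, Complex.sq_norm, Complex.normSq_apply]
    congr 1
    change s * (p.1 * p.1 + p.2 * p.2) = _
    ring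
  simp_rw [h]
  rw [integral_prod_mul (fun x => Real.exp (s * x ^ 2)) (fun x => Real.exp (s * x ^ 2)),
    integral_exp_sq_gaussianReal hs, Real.mul_self_sqrt]
  have : 0 < 1 - s := by linarith
  positivity

lemma le_stdComplexGaussian_square {c δ : ℝ} (hδ : 0 < δ) (hδ1 : δ ≤ 1) (hc : |c| * δ ≤ 1) :
    (δ * Real.exp (-3)) ^ 2 * Real.exp (-c ^ 2)
      ≤ stdComplexGaussian.real {z | |z.re - c| ≤ δ ∧ |z.im| ≤ δ} := by
  rw [stdComplexGaussian_eq, measureReal_def, MeasurableEquiv.map_apply, ← measureReal_def]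
  have h : Complex.measurableEquivRealProd.symm ⁻¹' {z | |z.re - c| ≤ δ ∧ |z.im| ≤ δ}
      = Set.Icc (c - δ) (c + δ) ×ˢ Set.Icc (0 - δ) (0 + δ) := by
    ext p
    change |p.1 - c| ≤ δ ∧ |p.2| ≤ δ ↔ (c - δ ≤ p.1 ∧ p.1 ≤ c + δ) ∧ (0 - δ ≤ p.2 ∧ p.2 ≤ 0 + δ)
    rw [abs_le, abs_le]
    constructor <;> rintro ⟨⟨h1, h2⟩, h3, h4⟩ <;> refine ⟨⟨?_, ?_⟩, ?_, ?_⟩ <;> linarith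
  rw [h, measureReal_prod_prod]
  have h1 := le_gaussianReal_Icc hδ1 hc
  have h2 := le_gaussianReal_Icc (c := 0) hδ1 (by simp)
  calc (δ * Real.exp (-3)) ^ 2 * Real.exp (-c ^ 2)
      = (δ * Real.exp (-3) * Real.exp (-c ^ 2)) * (δ * Real.exp (-3) * Real.exp (-0 ^ 2)) := by
        simp; ring
    _ ≤ _ := mul_le_mul h1 h2 (by positivity) measureReal_nonneg

end Gaussian

/-! ### Coordinate marginals of product measures -/

section Marginals

variable {ι Ω : Type*} [Fintype ι] [MeasurableSpace Ω] {ν : Measure Ω} [IsProbabilityMeasure ν]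

lemma integrable_comp_eval_pi {f : Ω → ℝ} (hf : Integrable f ν) (i : ι) :
    Integrable (fun H : ι → Ω => f (H i)) (Measure.pi fun _ => ν) :=
  (measurePreserving_eval (fun _ : ι => ν) i).integrable_comp_of_integrable hf

lemma integral_comp_eval_pi {f : Ω → ℝ} (hf : Integrable f ν) (i : ι) :
    ∫ H : ι → Ω, f (H i) ∂(Measure.pi fun _ => ν) = ∫ ω, f ω ∂ν := by
  have h := (measurePreserving_eval (fun _ : ι => ν) i).map_eq
  conv_rhs => rw [← h]
  rw [integral_map (measurable_pi_apply i).aemeasurable]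
  exact h.symm ▸ hf.aestronglyMeasurable

end Marginals

/-! ### Box probabilities, column moments and the SINR tail -/

section ChannelLaw

variable {Nr Nt : ℕ}

lemma measureReal_pi_pi {ι : Type*} [Fintype ι] {α : ι → Type*} [∀ i, MeasurableSpace (α i)]
    (μ : ∀ i, Measure (α i)) [∀ i, SigmaFinite (μ i)] (s : ∀ i, Set (α i)) :
    (Measure.pi μ).real (Set.univ.pi s) = ∏ i, (μ i).real (s i) := by
  simp only [measureReal_def, Measure.pi_pi, ENNReal.toReal_prod]

lemma le_channelLaw_box {Y : Fin Nr → Fin Nt → ℝ} {δ : ℝ} (hδ : 0 < δ) (hδ1 : δ ≤ 1)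
    (hY : ∀ i j, |Y i j| * δ ≤ 1) :
    (δ * Real.exp (-3)) ^ (2 * (Nr * Nt)) * Real.exp (-∑ i, ∑ j, Y i j ^ 2)
      ≤ (channelLaw Nr Nt).real (box Y δ) := by
  have h : box Y δ = Set.univ.pi fun i => Set.univ.pi fun j =>
      {z : ℂ | |z.re - Y i j| ≤ δ ∧ |z.im| ≤ δ} := by
    ext H; simp [box, Set.mem_pi]
  rw [h, channelLaw, measureReal_pi_pi]
  simp_rw [measureReal_pi_pi]
  calc (δ * Real.exp (-3)) ^ (2 * (Nr * Nt)) * Real.exp (-∑ i, ∑ j, Y i j ^ 2)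
      = ∏ i : Fin Nr, ∏ j : Fin Nt, ((δ * Real.exp (-3)) ^ 2 * Real.exp (-Y i j ^ 2)) := by
        simp_rw [Finset.prod_mul_distrib, ← Real.exp_sum, Finset.prod_const, Finset.card_univ,
          Fintype.card_fin, Finset.sum_neg_distrib]
        rw [pow_mul, mul_comm Nr Nt, pow_mul]
    _ ≤ _ := Finset.prod_le_prod (fun i _ => by positivity) fun i _ =>
        Finset.prod_le_prod (fun j _ => by positivity) fun j _ =>
          le_stdComplexGaussian_square hδ hδ1 (hY i j)

/-- The squared norm of a column is Gamma distributed: its moment generating function. -/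
lemma integral_exp_normSq_col {s : ℝ} (hs : s < 1) (k : Fin Nt) :
    ∫ H, Real.exp (s * normSq ((Matrix.of H).col k)) ∂(channelLaw Nr Nt)
      = (1 / (1 - s)) ^ Nr := by
  have h : ∀ H : Fin Nr → Fin Nt → ℂ, Real.exp (s * normSq ((Matrix.of H).col k))
      = ∏ i, Real.exp (s * ‖H i k‖ ^ 2) := by
    intro H
    rw [← Real.exp_sum, normSq, Finset.mul_sum]
    rfl
  simp_rw [h]
  rw [channelLaw, integral_fintype_prod_eq_prod
    (fun (_ : Fin Nr) (v : Fin Nt → ℂ) => Real.exp (s * ‖v k‖ ^ 2))]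
  have h2 : ∫ v : Fin Nt → ℂ, Real.exp (s * ‖v k‖ ^ 2)
      ∂(Measure.pi fun _ : Fin Nt => stdComplexGaussian) = 1 / (1 - s) := by
    rw [← integral_exp_normSq_stdComplexGaussian hs]
    refine integral_comp_eval_pi (f := fun z : ℂ => Real.exp (s * ‖z‖ ^ 2))
      (Integrable.of_integral_ne_zero ?_) k
    rw [integral_exp_normSq_stdComplexGaussian hs]
    exact one_div_ne_zero (by linarith)
  simp [h2]

lemma integrable_exp_normSq_col {s : ℝ} (hs : s < 1) (k : Fin Nt) :
    Integrable (fun H => Real.exp (s * normSq ((Matrix.of H).col k))) (channelLaw Nr Nt) := by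
  -- A non-integrable function would have integral `0`, so the nonzero value already proves
  -- integrability.
  refine Integrable.of_integral_ne_zero ?_
  rw [integral_exp_normSq_col hs k]
  have : 0 < 1 - s := by linarith
  positivity

/-- The upper tail of the SINR decays no faster than `exp (-t)` up to a polynomial factor. -/
lemma exists_le_channelLaw_sinr {ρ : ℝ} (r : Receiver) (hNr : 1 ≤ Nr) (hNt : 1 ≤ Nt)
    (hZF : r = Receiver.ZF → Nt ≤ Nr) (hρ : 0 < ρ) (k : Fin Nt) :
    ∃ C c : ℝ, 0 ≤ C ∧ 0 < c ∧ ∃ N : ℕ, ∀ t : ℝ, 1 ≤ t → C ≤ t →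
      c / t ^ N * Real.exp (-t)
        ≤ (channelLaw Nr Nt).real {H | ρ / Nt * (t - C) ≤ sinr r ρ (Matrix.of H) k} := by
  obtain ⟨C, hC0, hC⟩ := exists_box_le_sinr r hNr hNt hZF hρ k
  refine ⟨C, Real.exp (-3) ^ (2 * (Nr * Nt)) * Real.exp (-Nt), hC0, by positivity,
    2 * (Nr * Nt), fun t ht hCt => ?_⟩
  -- Take `y = √t` and `δ = 1 / t`. Each of the `2 Nr Nt` real coordinates costs a factor of order
  -- `1 / t`, and the energy bound gives `exp (-(t + Nt))`.
  have hy : 1 ≤ √t := Real.one_le_sqrt.2 ht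
  have hy2 : √t ^ 2 = t := Real.sq_sqrt (by linarith)
  obtain ⟨Y, hY1, hY2, hY3⟩ := hC (√t) hy (by rwa [hy2])
  rw [hy2] at hY1 hY3
  have hbox := le_channelLaw_box (Y := Y) (δ := 1 / t) (by positivity)
    (by rw [div_le_one (by linarith)]; exact ht) (fun i j => by
      rw [mul_one_div, div_le_one (by linarith)]
      nlinarith [hY2 i j])
  refine le_trans ?_ (hbox.trans (measureReal_mono (fun H hH => hY3 H hH)))
  calc _ = (1 / t * Real.exp (-3)) ^ (2 * (Nr * Nt)) * Real.exp (-(t + Nt)) := by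
        rw [neg_add, Real.exp_add, mul_pow, div_pow, one_pow]; ring
    _ ≤ _ := by gcongr

end ChannelLaw

/-! ### The expected logarithm of a maximum of independent copies -/

section Maximum

variable {Ω : Type*} {γ q : Ω → ℝ} {a : ℝ}

lemma iSup_comp_nonneg {K : ℕ} (hγ0 : ∀ ω, 0 ≤ γ ω) (H : Fin K → Ω) : 0 ≤ ⨆ i, γ (H i) :=
  Real.iSup_nonneg fun i => hγ0 (H i)

lemma log_one_add_iSup_nonneg {K : ℕ} (hγ0 : ∀ ω, 0 ≤ γ ω) (H : Fin K → Ω) :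
    0 ≤ Real.log (1 + ⨆ i, γ (H i)) :=
  Real.log_nonneg (by linarith [iSup_comp_nonneg hγ0 H])

/-- A bound of the logarithm of a maximum that is linear in the exponential moments, from two
tangent line estimates. -/
lemma log_one_add_iSup_le {K : ℕ} [NeZero K] (hγ0 : ∀ ω, 0 ≤ γ ω) (hγq : ∀ ω, γ ω ≤ a * q ω)
    (ha : 0 < a) {s A b : ℝ} (hs : 0 < s) (hA : 0 < A) (hb : 0 < b) (H : Fin K → Ω) :
    Real.log (1 + ⨆ i, γ (H i)) ≤ Real.log A +
      (1 + a / s * (Real.log b + (∑ i, Real.exp (s * q (H i))) / b - 1)) / A - 1 := by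
  have h1 : ⨆ i, γ (H i) ≤ a / s * (Real.log b + (∑ i, Real.exp (s * q (H i))) / b - 1) := by
    refine ciSup_le fun i => (hγq (H i)).trans ?_
    have h2 : s * q (H i) ≤ Real.log b + Real.exp (s * q (H i)) / b - 1 := by
      have := Real.log_le_sub_one_of_pos (x := Real.exp (s * q (H i)) / b) (by positivity)
      rw [Real.log_div (Real.exp_pos _).ne' hb.ne', Real.log_exp] at this
      linarith
    have h3 : Real.exp (s * q (H i)) / b ≤ (∑ i, Real.exp (s * q (H i))) / b := by
      gcongr
      exact Finset.single_le_sum (f := fun i => Real.exp (s * q (H i)))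
        (fun _ _ => (Real.exp_pos _).le) (Finset.mem_univ i)
    calc a * q (H i) = a / s * (s * q (H i)) := by field_simp
      _ ≤ _ := by gcongr; linarith
  have h0 := iSup_comp_nonneg hγ0 H
  have h4 := Real.log_le_sub_one_of_pos (x := (1 + ⨆ i, γ (H i)) / A) (by positivity)
  rw [Real.log_div (by positivity) hA.ne'] at h4
  have h5 : (1 + ⨆ i, γ (H i)) / A
      ≤ (1 + a / s * (Real.log b + (∑ i, Real.exp (s * q (H i))) / b - 1)) / A := by gcongr
  linarith

variable [MeasurableSpace Ω] {ν : Measure Ω} [IsProbabilityMeasure ν]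

lemma integrable_log_bound {K : ℕ} {s : ℝ} (hq : Integrable (fun ω => Real.exp (s * q ω)) ν)
    (A b : ℝ) : Integrable (fun H : Fin K → Ω => Real.log A +
      (1 + a / s * (Real.log b + (∑ i, Real.exp (s * q (H i))) / b - 1)) / A - 1)
      (Measure.pi fun _ => ν) := by
  have h := integrable_finsetSum (Finset.univ : Finset (Fin K))
    fun i _ => integrable_comp_eval_pi hq i
  exact ((integrable_const _).add (((integrable_const _).add (((integrable_const _).add
    (h.div_const _)).sub (integrable_const _) |>.const_mul _)).div_const _)).sub
      (integrable_const _)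

lemma measurable_log_one_add_iSup {K : ℕ} (hγ : Measurable γ) :
    Measurable fun H : Fin K → Ω => Real.log (1 + ⨆ i, γ (H i)) :=
  Real.measurable_log.comp
    (measurable_const.add (Measurable.iSup fun i => hγ.comp (measurable_pi_apply i)))

lemma integrable_log_one_add_iSup (K : ℕ) (hγ : Measurable γ) (hγ0 : ∀ ω, 0 ≤ γ ω)
    (hγq : ∀ ω, γ ω ≤ a * q ω) (ha : 0 < a) {s : ℝ} (hs : 0 < s)
    (hq : Integrable (fun ω => Real.exp (s * q ω)) ν) :
    Integrable (fun H : Fin K → Ω => Real.log (1 + ⨆ i, γ (H i))) (Measure.pi fun _ => ν) := by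
  rcases K.eq_zero_or_pos with rfl | hK
  -- With no users the supremum is the default value `0`, and the integrand is `log 1 = 0`.
  · simp
  · have : NeZero K := ⟨hK.ne'⟩
    refine (integrable_log_bound (a := a) hq 1 1).mono'
      (measurable_log_one_add_iSup hγ).aestronglyMeasurable (ae_of_all _ fun H => ?_)
    rw [Real.norm_of_nonneg (log_one_add_iSup_nonneg hγ0 H)]
    exact log_one_add_iSup_le hγ0 hγq ha hs one_pos one_pos H

/-- Taking `b = K m`, the mean of the sum of exponentials, makes the terms `S / b - 1` of the
pointwise bound cancel in expectation. -/
lemma integral_log_one_add_iSup_le {K : ℕ} [NeZero K] (hγ : Measurable γ) (hγ0 : ∀ ω, 0 ≤ γ ω)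
    (hγq : ∀ ω, γ ω ≤ a * q ω) (ha : 0 < a) {s A m : ℝ} (hs : 0 < s) (hA : 0 < A) (hm : 0 < m)
    (hq : Integrable (fun ω => Real.exp (s * q ω)) ν) (hqm : ∫ ω, Real.exp (s * q ω) ∂ν = m) :
    ∫ H : Fin K → Ω, Real.log (1 + ⨆ i, γ (H i)) ∂(Measure.pi fun _ => ν)
      ≤ Real.log A + (1 + a / s * Real.log (K * m)) / A - 1 := by
  have hb : (0 : ℝ) < K * m := mul_pos (Nat.cast_pos.2 (Nat.pos_of_neZero K)) hm
  refine (integral_mono (integrable_log_one_add_iSup K hγ hγ0 hγq ha hs hq)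
    (integrable_log_bound (a := a) hq A (K * m))
    fun H => log_one_add_iSup_le hγ0 hγq ha hs hA hb H).trans_eq ?_
  have h := integrable_finsetSum (Finset.univ : Finset (Fin K))
    fun i _ => integrable_comp_eval_pi hq i
  have hS : ∫ H : Fin K → Ω, ∑ i, Real.exp (s * q (H i)) ∂(Measure.pi fun _ => ν) = K * m := by
    rw [integral_finsetSum _ fun i _ => integrable_comp_eval_pi hq i]
    simp_rw [integral_comp_eval_pi hq, hqm]
    simp
  set b : ℝ := K * m
  have haffine : ∀ S : ℝ, Real.log A + (1 + a / s * (Real.log b + S / b - 1)) / A - 1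
      = (Real.log A + (1 + a / s * (Real.log b - 1)) / A - 1) + a / s / b / A * S :=
    fun S => by ring
  simp_rw [haffine]
  rw [integral_add (integrable_const _) (h.const_mul _), integral_const_mul, hS, integral_const,
    probReal_univ, one_smul]
  have : a / s / b / A * b = a / s / A := by field_simp
  rw [this]
  ring

/-- By independence all `K` copies stay below `x` with probability at most `(1 - p)^K ≤ exp (-p K)`.
Otherwise the logarithm is at least `log (1 + x)`. -/
lemma le_integral_log_one_add_iSup {K : ℕ} [NeZero K] (hγ : Measurable γ) (hγ0 : ∀ ω, 0 ≤ γ ω)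
    {x p : ℝ} (hx : 0 ≤ x) (hp : p ≤ ν.real {ω | x ≤ γ ω})
    (hint : Integrable (fun H : Fin K → Ω => Real.log (1 + ⨆ i, γ (H i))) (Measure.pi fun _ => ν)) :
    Real.log (1 + x) * (1 - Real.exp (-(p * K)))
      ≤ ∫ H : Fin K → Ω, Real.log (1 + ⨆ i, γ (H i)) ∂(Measure.pi fun _ => ν) := by
  set E : Set (Fin K → Ω) := Set.univ.pi fun _ => {ω | x ≤ γ ω}ᶜ with hE
  have hms : MeasurableSet {ω | x ≤ γ ω} := measurableSet_le measurable_const hγ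
  have hEm : MeasurableSet E := MeasurableSet.univ_pi fun _ => hms.compl
  have hlog : 0 ≤ Real.log (1 + x) := Real.log_nonneg (by linarith)
  have hPE : (Measure.pi fun _ : Fin K => ν).real E ≤ Real.exp (-(p * K)) := by
    rw [hE, measureReal_pi_pi]
    simp only [Finset.prod_const, Finset.card_univ, Fintype.card_fin]
    have h1 : ν.real {ω | x ≤ γ ω}ᶜ ≤ Real.exp (-p) := by
      rw [probReal_compl_eq_one_sub hms]
      linarith [Real.add_one_le_exp (-p)]
    calc ν.real {ω | x ≤ γ ω}ᶜ ^ K ≤ Real.exp (-p) ^ K := pow_le_pow_left₀ measureReal_nonneg h1 K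
      _ = Real.exp (-(p * K)) := by rw [← Real.exp_nat_mul]; congr 1; ring
  calc Real.log (1 + x) * (1 - Real.exp (-(p * K)))
      ≤ Real.log (1 + x) * (Measure.pi fun _ : Fin K => ν).real Eᶜ := by
        rw [probReal_compl_eq_one_sub hEm]
        gcongr
    _ = ∫ H, Eᶜ.indicator (fun _ => Real.log (1 + x)) H ∂(Measure.pi fun _ : Fin K => ν) := by
        rw [integral_indicator_const _ hEm.compl, smul_eq_mul, mul_comm]
    _ ≤ _ := by
        refine integral_mono ((integrable_const _).indicator hEm.compl) hint fun H => ?_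
        by_cases hH : H ∈ E
        · rw [Set.indicator_of_notMem (by simpa using hH)]
          exact log_one_add_iSup_nonneg hγ0 H
        · rw [Set.indicator_of_mem hH]
          simp only [hE, Set.mem_pi, Set.mem_univ, Set.mem_compl_iff, Set.mem_ofPred_eq, not_forall,
            not_not, true_implies] at hH
          obtain ⟨i, hi⟩ := hH
          have := le_ciSup (f := fun i => γ (H i)) (Set.finite_range _).bddAbove i
          exact Real.log_le_log (by linarith) (by linarith)

end Maximum

/-! ### Error estimates as `K` tends to infinity -/

section Asymptotics

variable {Ω : Type*} [MeasurableSpace Ω] {ν : Measure Ω} [IsProbabilityMeasure ν]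
  {γ q : Ω → ℝ} {a : ℝ}

lemma upper_bound_arith {a L n : ℝ} (ha : 0 < a) (hn : 0 ≤ n) (hL : 2 ≤ L)
    (hl : 1 ≤ Real.log L) :
    (1 + a / (1 - 1 / L) * (L + n * Real.log L)) / (a * L) - 1
      ≤ (1 / a + 2 * (1 + n)) * (Real.log L / L) := by
  have hL1 : 0 < L - 1 := by linarith
  have hL0 : 0 < L := by linarith
  have e : (1 + a / (1 - 1 / L) * (L + n * Real.log L)) / (a * L) - 1
      = 1 / a * (1 / L) + (1 + n * Real.log L) / (L - 1) := by
    have : 1 - 1 / L = (L - 1) / L := by field_simp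
    rw [this]
    field_simp
    ring
  rw [e, add_mul]
  gcongr
  rw [div_le_iff₀ hL1]
  have h1 : 1 ≤ 2 * (L - 1) / L := by rw [le_div_iff₀ hL0]; linarith
  calc 1 + n * Real.log L ≤ ((1 + n) * Real.log L) * 1 := by nlinarith
    _ ≤ ((1 + n) * Real.log L) * (2 * (L - 1) / L) := by gcongr
    _ = _ := by ring

/-- With `v` the relative loss, `v ≤ 1 / 2` gives `log (1 - v) ≥ -2 v`. -/
lemma lower_bound_arith {a L C m : ℝ} (ha : 0 < a) (hC : 0 ≤ C) (hm : 0 ≤ m) (hL : 2 ≤ L)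
    (hl : 1 ≤ Real.log L) (hsmall : (m + C) * (Real.log L / L) ≤ 1 / 2) :
    L / 2 ≤ L - m * Real.log L - C ∧
    Real.log (a * L) - 2 * (m + C) * (Real.log L / L)
      ≤ Real.log (a * (L - m * Real.log L - C)) := by
  have hL0 : 0 < L := by linarith
  set v := (m * Real.log L + C) / L with hv
  have hvle : v ≤ (m + C) * (Real.log L / L) := by
    rw [hv, ← mul_div_assoc]
    gcongr
    nlinarith
  have e : L - m * Real.log L - C = L * (1 - v) := by rw [hv]; field_simp; ring
  have hv1 : 1 / 2 ≤ 1 - v := by linarith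
  have hv0 : 0 ≤ v := by positivity
  refine ⟨by rw [e]; nlinarith, ?_⟩
  rw [e, ← mul_assoc, Real.log_mul (x := a * L) (y := 1 - v) (by positivity) (by linarith)]
  have h1 := Real.one_sub_inv_le_log_of_pos (x := 1 - v) (by linarith)
  have h2 : (1 - v)⁻¹ ≤ 1 + 2 * v := by
    rw [inv_le_iff_one_le_mul₀ (by linarith)]
    nlinarith
  linarith

/-- The logarithm of the maximum of `K` independent copies of a variable with exponential tails (up
to polynomial factors) is `log (a log K)` on average. -/
theorem isBigO_integral_log_one_add_iSup (hγ : Measurable γ) (hγ0 : ∀ ω, 0 ≤ γ ω)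
    (hγq : ∀ ω, γ ω ≤ a * q ω) (ha : 0 < a) {n : ℕ}
    (hq : ∀ s < 1, Integrable (fun ω => Real.exp (s * q ω)) ν)
    (hqs : ∀ s < 1, ∫ ω, Real.exp (s * q ω) ∂ν = (1 / (1 - s)) ^ n)
    {C c : ℝ} (hC : 0 ≤ C) (hc : 0 < c) {N : ℕ}
    (htail : ∀ t : ℝ, 1 ≤ t → C ≤ t →
      c / t ^ N * Real.exp (-t) ≤ ν.real {ω | a * (t - C) ≤ γ ω}) :
    (fun K : ℕ => ∫ H : Fin K → Ω, Real.log (1 + ⨆ i, γ (H i)) ∂(Measure.pi fun _ => ν)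
        - Real.log (a * Real.log K))
      =O[atTop] fun K : ℕ => Real.log (Real.log K) / Real.log K := by
  have hlogK : Tendsto (fun K : ℕ => Real.log K) atTop atTop :=
    Real.tendsto_log_atTop.comp tendsto_natCast_atTop_atTop
  have hev1 : ∀ᶠ L : ℝ in atTop, 1 ≤ Real.log L := Real.tendsto_log_atTop.eventually_ge_atTop 1
  have hev2 : ∀ᶠ L : ℝ in atTop, ((N + 1 : ℝ) + C) * (Real.log L / L) ≤ 1 / 2 := by
    have h := (Real.isLittleO_log_id_atTop.tendsto_div_nhds_zero).const_mul ((N + 1 : ℝ) + C)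
    rw [mul_zero] at h
    exact h.eventually_le_const (by norm_num)
  -- This makes the missed-threshold loss, at most `a L exp (-c L)`, no larger than `1 / L`.
  have hev3 : ∀ᶠ L : ℝ in atTop, a * L ^ 2 * Real.exp (-(c * L)) ≤ 1 := by
    have h := (Real.tendsto_pow_mul_exp_neg_atTop_nhds_zero 2).comp
      (tendsto_id.const_mul_atTop hc)
    have h2 := h.const_mul (a / c ^ 2)
    rw [mul_zero] at h2
    filter_upwards [h2.eventually_le_const one_pos] with L hL
    refine le_of_eq_of_le ?_ hL
    simp only [Function.comp, id]
    field_simp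
  refine Asymptotics.IsBigO.of_bound
    (max (1 / a + 2 * (1 + n)) (2 * ((N + 1 : ℝ) + C) + 1)) ?_
  filter_upwards [hlogK.eventually hev1, hlogK.eventually hev2, hlogK.eventually hev3,
    hlogK.eventually_ge_atTop 2, eventually_gt_atTop 0] with K hl hsmall hexp hL hK
  have : NeZero K := ⟨hK.ne'⟩
  have hK0 : (0 : ℝ) < K := Nat.cast_pos.2 hK
  have hKexp : (K : ℝ) = Real.exp (Real.log K) := (Real.exp_log hK0).symm
  set L := Real.log K with hLdef
  have hL0 : 0 < L := by linarith
  have hg : 0 ≤ Real.log L / L := by positivity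
  have hinv : L⁻¹ ≤ Real.log L / L := by rw [inv_eq_one_div]; gcongr
  rw [Real.norm_of_nonneg hg, Real.norm_eq_abs]
  set I := ∫ H : Fin K → Ω, Real.log (1 + ⨆ i, γ (H i)) ∂(Measure.pi fun _ => ν) with hI
  have hupper : I - Real.log (a * L) ≤ (1 / a + 2 * (1 + n)) * (Real.log L / L) := by
    -- The choice `s = 1 - 1 / L` keeps `a / s` within a factor `1 + O(1 / L)` of `a`, while the
    -- moment `Lⁿ` adds only `n log L` to `log K`.
    have hs1 : 1 - 1 / L < 1 := by
      have : 0 < 1 / L := by positivity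
      linarith
    have hs0 : 0 < 1 - 1 / L := by
      rw [sub_pos, div_lt_one hL0]; linarith
    have hm : (1 / (1 - (1 - 1 / L))) ^ n = L ^ n := by
      congr 1
      rw [sub_sub_cancel, one_div_one_div]
    have h1 := integral_log_one_add_iSup_le (K := K) hγ hγ0 hγq ha hs0
      (A := a * L) (by positivity) (m := L ^ n) (by positivity) (hq _ hs1)
      ((hqs _ hs1).trans hm)
    rw [Real.log_mul hK0.ne' (by positivity), Real.log_pow] at h1
    have h2 := upper_bound_arith ha n.cast_nonneg hL hl
    linarith
  have hlower : Real.log (a * L) - I ≤ (2 * ((N + 1 : ℝ) + C) + 1) * (Real.log L / L) := by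
    obtain ⟨h1, h2⟩ := lower_bound_arith ha hC (by positivity) hL hl hsmall
    -- Here `exp (-t) K = L ^ (N + 1)`: `N` powers of `L` absorb `t ^ N`, and the last one leaves `c
    -- L` as lower bound for the expected number of users above the threshold.
    set t := L - (N + 1 : ℝ) * Real.log L with ht
    have htL : t ≤ L := by
      have : 0 ≤ (N + 1 : ℝ) * Real.log L := by positivity
      linarith
    have ht1 : 1 ≤ t := by linarith
    have ht0 : 0 < t := by linarith
    have hx : 0 < a * (t - C) := mul_pos ha (by linarith)
    have h3 := le_integral_log_one_add_iSup (K := K) hγ hγ0 hx.le (htail t ht1 (by linarith))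
      (integrable_log_one_add_iSup K hγ hγ0 hγq ha one_half_pos (hq _ one_half_lt_one))
    have h4 : c * L ≤ c / t ^ N * Real.exp (-t) * K := by
      have e1 : Real.exp (-t) * K = L ^ (N + 1) := by
        rw [hKexp, ← Real.exp_add, ht]
        have : -(L - (N + 1 : ℝ) * Real.log L) + L = ((N + 1 : ℕ) : ℝ) * Real.log L := by
          push_cast; ring
        rw [this, Real.exp_nat_mul, Real.exp_log hL0]
      rw [mul_assoc, e1, div_mul_eq_mul_div, le_div_iff₀ (by positivity), pow_succ', ← mul_assoc]
      gcongr
    have h5 : Real.exp (-(c / t ^ N * Real.exp (-t) * K)) ≤ Real.exp (-(c * L)) := by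
      rw [Real.exp_le_exp]; linarith
    have h6 : Real.log (1 + a * (t - C)) ≤ a * L := by
      have := Real.log_le_sub_one_of_pos (x := 1 + a * (t - C)) (by linarith)
      have : a * (t - C) ≤ a * L := by gcongr; linarith
      linarith
    have h7 : Real.log (a * (t - C)) ≤ Real.log (1 + a * (t - C)) :=
      Real.log_le_log hx (by linarith)
    have h8 : Real.log (1 + a * (t - C)) * Real.exp (-(c / t ^ N * Real.exp (-t) * K))
        ≤ L⁻¹ := by
      calc _ ≤ a * L * Real.exp (-(c * L)) := by gcongr
        _ = a * L ^ 2 * Real.exp (-(c * L)) * L⁻¹ := by field_simp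
        _ ≤ 1 * L⁻¹ := by gcongr
        _ = L⁻¹ := one_mul _
    rw [mul_sub, mul_one] at h3
    linarith
  rw [abs_le]
  constructor
  · have := mul_le_mul_of_nonneg_right
      (le_max_right (1 / a + 2 * (1 + n)) (2 * ((N + 1 : ℝ) + C) + 1)) hg
    linarith
  · have := mul_le_mul_of_nonneg_right
      (le_max_left (1 / a + 2 * (1 + n)) (2 * ((N + 1 : ℝ) + C) + 1)) hg
    linarith

end Asymptotics

end MIMO

end

/-! ### Summation over the antennas and change to base 2 -/

theorem corollary1 (r : MIMO.Receiver) (Nr Nt : ℕ) (hNr : 1 ≤ Nr) (hNt : 1 ≤ Nt)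
    (hZF : r = MIMO.Receiver.ZF → Nt ≤ Nr) (ρ : ℝ) (hρ : 0 < ρ) :
    (∀ (K : ℕ) (k : Fin Nt),
      Integrable (fun H : Fin K → Fin Nr → Fin Nt → ℂ => MIMO.streamRate r ρ k H)
        (MIMO.usersLaw K Nr Nt)) ∧
    (fun K : ℕ => MIMO.maxSumRate r ρ Nr Nt K
        - Nt * (Real.logb 2 (Real.log K) + Real.logb 2 ρ - Real.logb 2 Nt))
      =O[atTop] fun K : ℕ => Real.log (Real.log K) / Real.log K := by
  have ha : 0 < ρ / Nt := by positivity
  refine ⟨fun K k => (MIMO.integrable_log_one_add_iSup K (MIMO.measurable_sinr r ρ k)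
    (fun H => MIMO.sinr_nonneg _ k r hρ) (fun H => MIMO.sinr_le _ k r hρ) ha one_half_pos
    (MIMO.integrable_exp_normSq_col one_half_lt_one k)).div_const _, ?_⟩
  have hstream : ∀ k : Fin Nt, (fun K : ℕ => ∫ H : Fin K → Fin Nr → Fin Nt → ℂ,
      Real.log (1 + ⨆ i, MIMO.sinr r ρ (Matrix.of (H i)) k)
        ∂(Measure.pi fun _ => MIMO.channelLaw Nr Nt) - Real.log (ρ / Nt * Real.log K))
      =O[atTop] fun K : ℕ => Real.log (Real.log K) / Real.log K := by
    intro k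
    obtain ⟨C, c, hC, hc, N, htail⟩ := MIMO.exists_le_channelLaw_sinr r hNr hNt hZF hρ k
    exact MIMO.isBigO_integral_log_one_add_iSup (MIMO.measurable_sinr r ρ k)
      (fun H => MIMO.sinr_nonneg _ k r hρ) (fun H => MIMO.sinr_le _ k r hρ) ha
      (fun s hs => MIMO.integrable_exp_normSq_col hs k)
      (fun s hs => MIMO.integral_exp_normSq_col hs k) hC hc htail
  refine ((Asymptotics.IsBigO.sum (s := Finset.univ)
    fun k _ => hstream k).const_mul_left (Real.log 2)⁻¹).congr' ?_ EventuallyEq.rfl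
  have hlogK : Tendsto (fun K : ℕ => Real.log K) atTop atTop :=
    Real.tendsto_log_atTop.comp tendsto_natCast_atTop_atTop
  filter_upwards [hlogK.eventually_gt_atTop 0] with K hL
  have hrate : ∀ k : Fin Nt, ∫ H, MIMO.streamRate r ρ k H ∂(MIMO.usersLaw K Nr Nt)
      = (Real.log 2)⁻¹ * ∫ H : Fin K → Fin Nr → Fin Nt → ℂ,
        Real.log (1 + ⨆ i, MIMO.sinr r ρ (Matrix.of (H i)) k)
          ∂(Measure.pi fun _ => MIMO.channelLaw Nr Nt) := by
    intro k
    rw [mul_comm, ← div_eq_mul_inv, ← integral_div]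
    rfl
  have hNt0 : (Nt : ℝ) ≠ 0 := by positivity
  simp only [MIMO.maxSumRate, hrate, Finset.sum_apply, Finset.sum_sub_distrib, Finset.sum_const, Finset.card_univ,
    Fintype.card_fin, nsmul_eq_mul, ← Finset.mul_sum]
  rw [Real.log_mul ha.ne' hL.ne', Real.log_div hρ.ne' hNt0]
  simp only [Real.logb, div_eq_mul_inv]
  ring
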